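/- Let $p$ be a prime and $\Sigma_p=\{0<1<\dots<p-1\}$. A \emph{necklace} of length $n$ over $\Sigma_p$ is a conjugacy class $[w]$ (the set of all rotations) of a word $w\in\Sigma_p^n$; it is \emph{aperiodic} if $w$ is primitive, i.e. $w=v^m$ with $v$ a nonempty word implies $m=1$. The \emph{weight} of $[w]$ is the sum of the letters of $w$. The \emph{Burrows--Wheeler matrix} of $[w]$ is the $n\times n$ matrix whose rows are the $n$ rotations of $w$ in ascending lexicographic order, and $[w]$ is \emph{invertible} if the determinant of this matrix is nonzero modulo $p$. For an integer $a$, a prime $q$ is called \emph{$a$-rooted} if (the residue class of) $a$ is a generator of the multiplicative group $\mathrm{GF}_q^*$. Consider, for a prime $p$, the following two assertions. $\mathrm{N}(p)$: there exist infinitely many positive integers $n$, different from a power of $p$, such that every aperiodic necklace of length $n$ over $\Sigma_p$ whose weight is nonzero modulo $p$ is invertible. $\mathrm{A}(p)$ (Artin's conjecture for the base $p$): there exist infinitely many $p$-rooted primes. Then for every prime $p$, $\mathrm{N}(p)$ holds if and only if $\mathrm{A}(p)$ holds. In particular, the conjecture that $\mathrm{N}(p)$ holds for all primes $p$ is equivalent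 to the restriction of Artin's conjecture to (positive) prime bases, i.e. to the assertion that $\mathrm{A}(p)$ holds for all primes $p$. -/

import Mathlib

namespace InvNeck

/-- The ordered alphabet `Σ_k = {0 < 1 < ⋯ < k - 1}`. Words are lists of letters. -/
abbrev Word (k : ℕ) : Type := List (Fin k)

/-- A necklace is a conjugacy class of words: a list of letters up to rotation. -/
abbrev Necklace (k : ℕ) : Type := Cycle (Fin k)

/-- The `m`-th power of a word: the concatenation of `m` copies of it. -/
def wordPow {k : ℕ} (v : Word k) (m : ℕ) : Word k := (List.replicate m v).flatten

/-- A word `w` is primitive if `w = v ^ m` with `v` nonempty forces `m = 1`. -/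
def IsPrimitive {k : ℕ} (w : Word k) : Prop :=
  ∀ (v : Word k) (m : ℕ), v ≠ [] → w = wordPow v m → m = 1

/-- An aperiodic necklace is a conjugacy class of primitive words. -/
def IsAperiodic {k : ℕ} (c : Necklace k) : Prop :=
  ∀ w : Word k, (w : Necklace k) = c → IsPrimitive w

/-- The weight of a necklace: the sum (in `ℕ`) of the letters of any of its representatives. -/
def weight {k : ℕ} (c : Necklace k) : ℕ := (c.toMultiset.map Fin.val).sum

/-- The weight of the necklace `[w]` is the sum of the letters of `w`. -/
theorem weight_coe {k : ℕ} (w : Word k) :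
    weight (w : Necklace k) = (w.map Fin.val).sum := by
  simp [weight]

/-- The shifts of a representative of the necklace (as many as its length, with multiplicity),
listed in ascending lexicographic order. -/
def bwtRows {k : ℕ} (c : Necklace k) : List (Word k) := c.lists.sort (· ≤ ·)

theorem lt_length_bwtRows {k : ℕ} (c : Necklace k) (i : Fin c.length) :
    (i : ℕ) < (bwtRows c).length := by
  have hi := i.2
  generalize (i : ℕ) = m at hi
  clear i
  induction c using Quotient.inductionOn' with
  | h w =>
    have hw : w ≠ [] := by
      rintro rfl
      exact absurd hi (Nat.not_lt_zero _)
    have h2 : (bwtRows (w : Necklace k)).length = w.length := by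
      simp [bwtRows, List.length_cyclicPermutations_of_ne_nil _ hw]
    exact hi.trans_eq h2.symm

theorem length_of_mem_bwtRows {k : ℕ} (c : Necklace k) {w : Word k} (hw : w ∈ bwtRows c) :
    w.length = c.length := by
  have h : (w : Necklace k) = c := by
    rw [bwtRows, Multiset.mem_sort] at hw
    exact Cycle.mem_lists_iff_coe_eq.1 hw
  rw [← h, Cycle.length_coe]

/-- The Burrows–Wheeler matrix: row `i` is the `i`-th shift in lexicographic order. -/
def bwtMatrix {k : ℕ} (c : Necklace k) : Matrix (Fin c.length) (Fin c.length) (Fin k) :=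
  Matrix.of fun i j =>
    ((bwtRows c)[(i : ℕ)]'(lt_length_bwtRows c i))[(j : ℕ)]'(by
      rw [length_of_mem_bwtRows c (List.getElem_mem (lt_length_bwtRows c i))]
      exact j.2)

/-- A necklace over `Σ_p` is invertible if its Burrows–Wheeler matrix has nonzero determinant
modulo `p`. -/
def IsInvertible {p : ℕ} (c : Necklace p) : Prop :=
  ((bwtMatrix c).map fun a => ((a : ℕ) : ZMod p)).det ≠ 0

/-- Every aperiodic necklace of length `n` over `Σ_p` with nonzero weight modulo `p` is
invertible. -/
def AllInvertible (p n : ℕ) : Prop :=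
  ∀ c : Necklace p, c.length = n → IsAperiodic c → ¬ p ∣ weight c → IsInvertible c

/-- `q` is an `a`-rooted prime: `q` is prime and (the class of) `a` is a generator of the
multiplicative group of the field with `q` elements. -/
def IsRootedPrime (a : ℤ) (q : ℕ) : Prop :=
  q.Prime ∧ ∃ u : (ZMod q)ˣ, (u : ZMod q) = (a : ZMod q) ∧ Subgroup.zpowers u = ⊤

/-- The conjecture on invertible necklaces at `p`: there are infinitely many lengths `n ≥ 1`,
different from a power of `p`, for which every aperiodic necklace of length `n` over `Σ_p` with
nonzero weight modulo `p` is invertible. -/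
def NecklaceConjectureAt (p : ℕ) : Prop :=
  {n : ℕ | 0 < n ∧ (¬ ∃ e : ℕ, n = p ^ e) ∧ AllInvertible p n}.Infinite

/-- The assertion of Artin's conjecture at the base `a`: there are infinitely many `a`-rooted
primes. (The full conjecture asserts this for every integer `a` that is neither a square
nor `-1`; in particular for every prime number.) -/
def ArtinConjectureAt (a : ℤ) : Prop :=
  {q : ℕ | IsRootedPrime a q}.Infinite

end InvNeck

namespace InvNeck

open Polynomial

/-! ### Primitive words -/

/-! Read the letters of `w` as the coefficients of a polynomial `W` of degree less than `n` over the
field with `p` elements. Up to row order the Burrows–Wheeler matrix is a circulant-type matrix, so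
`[w]` is invertible iff `W` is coprime to `X ^ n - 1` (`isInvertible_coe_iff`); nonzero weight means
`W(1) ≠ 0`.

For `n` not a power of `p`, all these necklaces are invertible iff `n` is a `p`-rooted prime, so the
two infinite sets coincide. If `n` is not such a prime, a divisor of `X ^ n - 1` (`Φ_r` for a prime
`r < n`, or a proper factor of `Φ_n`) spells a primitive non-invertible word. If `n` is, then `Φ_n`
is irreducible, and only constant words or words of zero weight share a factor with `X ^ n - 1 = Φ_n
(X - 1)`. -/

theorem length_wordPow {k : ℕ} (v : Word k) (m : ℕ) : (wordPow v m).length = m * v.length := by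
  simp [wordPow]

theorem wordPow_succ {k : ℕ} (v : Word k) (m : ℕ) : wordPow v (m + 1) = v ++ wordPow v m := by
  simp [wordPow, List.replicate_succ]

theorem wordPow_cons_append_singleton {k : ℕ} (a : Fin k) (t : Word k) (m : ℕ) :
    wordPow (a :: t) m ++ [a] = a :: wordPow (t ++ [a]) m := by
  induction m with
  | zero => simp [wordPow]
  | succ m ih => simp [wordPow_succ, ih]

theorem rotate_one_wordPow {k : ℕ} (v : Word k) (m : ℕ) :
    (wordPow v m).rotate 1 = wordPow (v.rotate 1) m := by
  cases v with
  | nil => simp [wordPow]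
  | cons a t =>
    cases m with
    | zero => simp [wordPow]
    | succ m => simp [wordPow_succ, wordPow_cons_append_singleton]

theorem rotate_wordPow {k : ℕ} (v : Word k) (m j : ℕ) :
    (wordPow v m).rotate j = wordPow (v.rotate j) m := by
  induction j with
  | zero => simp
  | succ j ih => rw [← List.rotate_rotate, ih, rotate_one_wordPow, List.rotate_rotate]

theorem isAperiodic_coe {k : ℕ} (w : Word k) :
    IsAperiodic (w : Necklace k) ↔ IsPrimitive w := by
  refine ⟨fun h => h w rfl, fun h w' hw' v m hv hpow => ?_⟩
  obtain ⟨j, hj⟩ := Cycle.coe_eq_coe.1 hw'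
  refine h (v.rotate j) m (by simpa using hv) ?_
  rw [← hj, hpow, rotate_wordPow]

theorem getElem?_wordPow {k : ℕ} (v : Word k) (m i : ℕ) (hi : i < m * v.length) :
    (wordPow v m)[i]? = v[i % v.length]? := by
  induction m generalizing i with
  | zero => simp at hi
  | succ m ih =>
    rw [wordPow_succ]
    by_cases h : i < v.length
    · rw [List.getElem?_append_left h, Nat.mod_eq_of_lt h]
    · push Not at h
      rw [List.getElem?_append_right h, ih _ (by rw [Nat.succ_mul] at hi; omega),
        ← Nat.mod_eq_sub_mod h]

/-- A word of prime length with two distinct letters is primitive. -/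
theorem isPrimitive_of_prime_length {k : ℕ} {w : Word k} (hw : w.length.Prime)
    {i j : Fin w.length} (hij : w[i] ≠ w[j]) : IsPrimitive w := by
  intro v m hv hpow
  have hlen : w.length = m * v.length := by rw [← length_wordPow, ← hpow]
  rcases (Nat.dvd_prime hw).1 (Dvd.intro _ hlen.symm) with h | h
  · exact h
  · exfalso
    have hv1 : v.length = 1 := by
      have := hw.pos
      rw [h] at hlen
      exact Nat.eq_of_mul_eq_mul_left this (by omega)
    have key : ∀ i : Fin w.length, some w[i] = v[0]? := by
      intro i
      have := getElem?_wordPow v m i (by rw [← hlen]; exact i.2)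
      rw [← hpow, hv1, Nat.mod_one] at this
      simpa using this
    exact hij (Option.some.inj ((key i).trans (key j).symm))

theorem not_isPrimitive_of_const {k : ℕ} {w : Word k} (hw : 1 < w.length) {a : Fin k}
    (h : ∀ b ∈ w, b = a) : ¬ IsPrimitive w := by
  intro hp
  have := hp [a] w.length (by simp) (by
    simpa [wordPow] using List.eq_replicate_of_mem h)
  omega

/-- A word of the shape `aʳbˢ` with `a ≠ b` and `r, s > 0` is primitive. -/
theorem isPrimitive_of_two_blocks {k : ℕ} {w : Word k} {r : ℕ} (hr : 0 < r) (hrw : r < w.length)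
    {a b : Fin k} (hab : a ≠ b) (ha : ∀ i (h : i < w.length), i < r → w[i] = a)
    (hb : ∀ i (h : i < w.length), r ≤ i → w[i] = b) : IsPrimitive w := by
  intro v m hv hpow
  have hlen : w.length = m * v.length := by rw [← length_wordPow, ← hpow]
  have hl : 0 < v.length := List.length_pos_iff.2 hv
  have key : ∀ i (h : i < w.length), some w[i] = v[i % v.length]? := by
    intro i h
    rw [← getElem?_wordPow v m i (by rw [← hlen]; exact h), ← hpow]
    simp
  have periodic : ∀ i j (hi : i < w.length) (hj : j < w.length), i % v.length = j % v.length →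
      w[i] = w[j] := by
    intro i j hi hj hij
    exact Option.some.inj ((key i hi).trans (hij ▸ (key j hj).symm))
  by_contra hm
  have hm2 : 2 ≤ m := by
    rcases m with _ | _ | m
    · simp at hlen; simp [hlen] at hrw
    · simp at hm
    · omega
  have hlw : v.length < w.length := by nlinarith
  -- Positions `0` and `v.length` agree, so the period ends inside the first block.
  have hlr : v.length < r := by
    by_contra hlr
    have := periodic 0 v.length (by omega) hlw (by simp)
    rw [ha 0 _ hr, hb _ _ (by omega)] at this
    exact hab this
  -- The last letters of the first and last copies of `v` agree, but lie in different blocks.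
  have := periodic (v.length - 1) (w.length - 1) (by omega) (by omega) (by
    obtain ⟨m, rfl⟩ : ∃ m', m = m' + 1 := ⟨m - 1, by omega⟩
    have : w.length - 1 = v.length - 1 + v.length * m := by
      rw [hlen, Nat.succ_mul, Nat.mul_comm]; omega
    rw [this, Nat.add_mul_mod_self_left])
  rw [ha _ _ (by omega), hb _ _ (by omega)] at this
  exact hab this

/-! ### The polynomial of a word -/

/-- The polynomial over `ZMod p` whose coefficients are the letters of the word. -/
noncomputable def wordPoly {p : ℕ} (w : Word p) : (ZMod p)[X] :=
  ∑ i : Fin w.length, monomial (i : ℕ) (((w[i] : Fin p) : ℕ) : ZMod p)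

theorem coeff_wordPoly {p : ℕ} (w : Word p) (i : ℕ) (hi : i < w.length) :
    (wordPoly w).coeff i = (((w[i] : Fin p) : ℕ) : ZMod p) := by
  rw [wordPoly, finsetSum_coeff, Finset.sum_eq_single ⟨i, hi⟩]
  · simp
  · intro j _ hj
    exact coeff_monomial_of_ne _ fun h => hj (Fin.ext h.symm)
  · simp

theorem degree_wordPoly_lt {p : ℕ} (w : Word p) : (wordPoly w).degree < w.length := by
  refine (degree_sum_le _ _).trans_lt ((Finset.sup_lt_iff (WithBot.bot_lt_coe _)).2 fun i _ => ?_)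
  exact (degree_monomial_le _ _).trans_lt (by exact_mod_cast i.2)

theorem eval_one_wordPoly {p : ℕ} (w : Word p) :
    (wordPoly w).eval 1 = (weight (w : Necklace p) : ZMod p) := by
  rw [weight_coe, wordPoly, eval_finsetSum, Nat.cast_list_sum, List.map_map,
    ← Fin.sum_univ_fun_getElem]
  simp

/-- The word of length `n` whose letters are the first `n` coefficients of the polynomial. -/
def polyWord {p : ℕ} [NeZero p] (n : ℕ) (f : (ZMod p)[X]) : Word p :=
  List.ofFn fun i : Fin n => ⟨(f.coeff i).val, ZMod.val_lt _⟩

theorem length_polyWord {p : ℕ} [NeZero p] (n : ℕ) (f : (ZMod p)[X]) :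
    (polyWord n f).length = n := by simp [polyWord]

theorem getElem_polyWord {p : ℕ} [NeZero p] (n : ℕ) (f : (ZMod p)[X]) (i : ℕ)
    (hi : i < (polyWord n f).length) :
    (polyWord n f)[i] = ⟨(f.coeff i).val, ZMod.val_lt _⟩ := by simp [polyWord]

theorem wordPoly_polyWord {p : ℕ} [NeZero p] {n : ℕ} {f : (ZMod p)[X]} (hf : f.degree < n) :
    wordPoly (polyWord n f) = f := by
  ext i
  by_cases hi : i < n
  · rw [coeff_wordPoly _ _ (by rwa [length_polyWord]), getElem_polyWord]
    simp
  · have hi : ((n : ℕ) : WithBot ℕ) ≤ i := by exact_mod_cast not_lt.1 hi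
    rw [coeff_eq_zero_of_degree_lt (hf.trans_le hi), coeff_eq_zero_of_degree_lt]
    refine (degree_wordPoly_lt _).trans_le ?_
    rwa [length_polyWord]

/-! ### The shift operator -/

/-- The cyclic shift of functions on `Fin n`. -/
def shift (F : Type*) [Field F] (n : ℕ) [NeZero n] : Module.End F (Fin n → F) :=
  LinearMap.funLeft F F (· + 1)

theorem shift_pow_apply {F : Type*} [Field F] {n : ℕ} [NeZero n] (i : ℕ) (x : Fin n → F)
    (b : Fin n) : (shift F n ^ i) x b = x (b + Fin.ofNat n i) := by
  induction i generalizing b with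
  | zero => simp
  | succ i ih =>
    rw [pow_succ', Module.End.mul_apply, shift, LinearMap.funLeft_apply, ← shift, ih]
    congr 1
    ext
    simp only [Fin.val_add, Fin.val_ofNat, Fin.val_one']
    simp [Nat.add_assoc, Nat.add_comm 1]

theorem aeval_shift_X_pow_sub_one {F : Type*} [Field F] {n : ℕ} [NeZero n] :
    aeval (shift F n) (X ^ n - 1 : F[X]) = 0 := by
  ext x b
  simp [shift_pow_apply]

theorem aeval_shift_apply {F : Type*} [Field F] {n : ℕ} [NeZero n] {f : F[X]}
    (hf : f.degree < n) (x : Fin n → F) (b : Fin n) :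
    aeval (shift F n) f x b = ∑ i : Fin n, f.coeff i * x (b + i) := by
  have hf' : f.natDegree < n := by
    by_cases h0 : f = 0
    · simpa [h0] using Nat.pos_of_ne_zero (NeZero.ne n)
    · exact (natDegree_lt_iff_degree_lt h0).2 hf
  rw [aeval_eq_sum_range' hf', LinearMap.sum_apply, Finset.sum_apply, Finset.sum_range]
  refine Finset.sum_congr rfl fun i _ => ?_
  simp [shift_pow_apply]

/-- Since `X ^ n - 1` annihilates the shift, a Bézout relation inverts `f(shift)`. Conversely, a
common factor `g` with `X ^ n - 1 = g * t` gives a kernel vector: `t(shift)` applied to the basis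
vector at `0`, whose entry at `-i` is the `i`-th coefficient of `t`. -/
theorem isCoprime_X_pow_sub_one_iff {F : Type*} [Field F] {n : ℕ} [NeZero n] {f : F[X]} :
    IsCoprime f (X ^ n - 1) ↔ ∀ x, aeval (shift F n) f x = 0 → x = 0 := by
  have hn : 0 < n := Nat.pos_of_ne_zero (NeZero.ne n)
  have hX : (X ^ n - 1 : F[X]) ≠ 0 := (monic_X_pow_sub_C (1 : F) hn.ne').ne_zero
  constructor
  · rintro ⟨a, b, hab⟩ x hx
    rw [← Module.End.one_apply (R := F) x, ← map_one (aeval (R := F) (shift F n)), ← hab, map_add, map_mul,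
      map_mul, aeval_shift_X_pow_sub_one, mul_zero, add_zero, Module.End.mul_apply, hx, map_zero]
  · intro h
    refine isCoprime_of_irreducible_dvd (fun h0 => hX h0.2) ?_
    rintro g hg ⟨s, rfl⟩ ⟨t, ht⟩
    have ht0 : t ≠ 0 := by rintro rfl; simp at ht; exact hX ht
    have htdeg : t.degree < n := by
      have h1 : (X ^ n - 1 : F[X]).natDegree = n := natDegree_X_pow_sub_C
      rw [ht, natDegree_mul hg.ne_zero ht0] at h1
      rw [← natDegree_lt_iff_degree_lt ht0]
      have := hg.natDegree_pos
      omega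
    have hzero : aeval (shift F n) t (Pi.single 0 1) = 0 := by
      apply h
      rw [← Module.End.mul_apply, ← map_mul, show g * s * t = s * (g * t) by ring, ← ht, map_mul,
        aeval_shift_X_pow_sub_one, mul_zero, LinearMap.zero_apply]
    apply ht0
    ext i
    by_cases hi : i < n
    · have := congrFun hzero (-⟨i, hi⟩)
      rw [aeval_shift_apply htdeg, Finset.sum_eq_single ⟨i, hi⟩] at this
      · simpa using this
      · intro j _ hj
        rw [Pi.single_eq_of_ne, mul_zero]
        rw [neg_add_eq_sub]
        exact sub_ne_zero.2 hj
      · simp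
    · rw [coeff_eq_zero_of_degree_lt, coeff_zero]
      exact htdeg.trans_le (by exact_mod_cast not_lt.1 hi)

/-! ### The Burrows–Wheeler determinant -/

theorem mem_bwtRows_coe {k : ℕ} {w u : Word k} : u ∈ bwtRows (w : Necklace k) ↔ u ~r w := by
  rw [bwtRows, Multiset.mem_sort, Cycle.mem_lists_iff_coe_eq, Cycle.coe_eq_coe]

theorem length_bwtRows_coe {k : ℕ} {w : Word k} (hw : w ≠ []) :
    (bwtRows (w : Necklace k)).length = w.length := by
  simp [bwtRows, List.length_cyclicPermutations_of_ne_nil _ hw]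

theorem bwtMatrix_coe_apply {k : ℕ} {w : Word k} {i : Fin (w : Necklace k).length} {c : ℕ}
    (hc : (bwtRows (w : Necklace k))[(i : ℕ)]'(lt_length_bwtRows _ i) = w.rotate c)
    (j : Fin w.length) :
    bwtMatrix (w : Necklace k) i j = w[(j + c) % w.length]'(Nat.mod_lt _ j.pos) := by
  rw [← List.getElem_rotate w c j (by simp)]
  change ((bwtRows (w : Necklace k))[(i : ℕ)]'(lt_length_bwtRows _ i))[(j : ℕ)]'_ = _
  simp only [hc]

theorem mulVec_bwtMatrix_coe {p : ℕ} {w : Word p} {i : Fin (w : Necklace p).length} {c : ℕ}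
    (hc : (bwtRows (w : Necklace p))[(i : ℕ)]'(lt_length_bwtRows _ i) = w.rotate c)
    (x : Fin w.length → ZMod p) :
    ((bwtMatrix (w : Necklace p)).map fun a => ((a : ℕ) : ZMod p)).mulVec x i =
      ∑ j : Fin w.length,
        (((w[(j + c) % w.length]'(Nat.mod_lt _ j.pos) : Fin p) : ℕ) : ZMod p) * x j := by
  change ∑ j : Fin w.length, ((bwtMatrix (w : Necklace p) i j : ℕ) : ZMod p) * x j = _
  exact Finset.sum_congr rfl fun j _ => by rw [bwtMatrix_coe_apply hc]

/-- The row `w.rotate c` paired with `x` is the entry at `-c` of `W(shift) x`. Every rotation occurs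
as a row, so both operators have the same kernel, whatever the order of the rows. -/
theorem isInvertible_coe_iff {p : ℕ} [Fact p.Prime] {w : Word p} (hw : w ≠ []) :
    IsInvertible (w : Necklace p) ↔ IsCoprime (wordPoly w) (X ^ w.length - 1) := by
  have hpos : 0 < w.length := List.length_pos_iff.2 hw
  have : NeZero w.length := ⟨hpos.ne'⟩
  have hdet : IsInvertible (w : Necklace p) ↔ ∀ x : Fin (w : Necklace p).length → ZMod p,
      ((bwtMatrix (w : Necklace p)).map fun a => ((a : ℕ) : ZMod p)).mulVec x = 0 → x = 0 := by
    rw [IsInvertible, ne_eq, ← Matrix.exists_mulVec_eq_zero_iff]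
    push Not
    exact forall_congr' fun x => not_imp_not
  rw [isCoprime_X_pow_sub_one_iff, hdet]
  refine forall_congr' fun (x : Fin w.length → ZMod p) => imp_congr_left ?_
  have hshift : ∀ c : Fin w.length, aeval (shift (ZMod p) w.length) (wordPoly w) x (-c) =
      ∑ j : Fin w.length, (((w[(j + c : Fin w.length)] : Fin p) : ℕ) : ZMod p) * x j := by
    intro c
    rw [aeval_shift_apply (degree_wordPoly_lt w), ← Equiv.sum_comp (Equiv.addRight c)]
    refine Finset.sum_congr rfl fun i _ => ?_
    rw [coeff_wordPoly _ _ (Fin.is_lt _)]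
    simp
  constructor
  · intro hM
    ext b
    obtain ⟨c, rfl⟩ : ∃ c, b = -c := ⟨-b, by simp⟩
    have hmem : w.rotate c ∈ bwtRows (w : Necklace p) :=
      mem_bwtRows_coe.2 (List.IsRotated.symm ⟨c, rfl⟩)
    obtain ⟨i, hi, hiw⟩ := List.getElem_of_mem hmem
    have := congrFun hM ⟨i, by rwa [length_bwtRows_coe hw] at hi⟩
    rw [mulVec_bwtMatrix_coe hiw] at this
    rw [hshift]
    simpa [Fin.val_add] using this
  · intro hS
    ext i
    have hmem := List.getElem_mem (lt_length_bwtRows (w : Necklace p) i)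
    obtain ⟨c, hc⟩ := (mem_bwtRows_coe.1 hmem).symm
    have := congrFun hS (-Fin.ofNat w.length c)
    rw [hshift] at this
    rw [mulVec_bwtMatrix_coe hc.symm]
    simpa [Fin.val_add] using this

/-! ### Lengths for which every necklace of nonzero weight is invertible -/

theorem wordPoly_eval_one_ne_zero_iff {p : ℕ} {w : Word p} :
    ¬ p ∣ weight (w : Necklace p) ↔ (wordPoly w).eval 1 ≠ 0 := by
  rw [eval_one_wordPoly, Ne, ZMod.natCast_eq_zero_iff]

theorem cyclotomic_dvd_X_pow_sub_one (F : Type*) [Field F] {r n : ℕ} (h : r ∣ n) :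
    cyclotomic r F ∣ X ^ n - 1 :=
  (cyclotomic.dvd_X_pow_sub_one r F).trans (dvd_pow_sub_one_of_dvd h)

/-- A nonconstant divisor of `X ^ n - 1` of degree less than `n` that does not vanish at `1` cannot
be the polynomial of a primitive word, when all aperiodic necklaces of length `n` and nonzero weight
are invertible. -/
theorem AllInvertible.not_isPrimitive_polyWord {p n : ℕ} [Fact p.Prime] (h : AllInvertible p n)
    {f : (ZMod p)[X]} (hdeg : f.degree < n) (hf : ¬ IsUnit f) (hdvd : f ∣ X ^ n - 1)
    (h1 : f.eval 1 ≠ 0) : ¬ IsPrimitive (polyWord n f) := by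
  intro hprim
  have hlen := length_polyWord n f
  have hinv := h (polyWord n f : Necklace p) (by simp [hlen]) ((isAperiodic_coe _).2 hprim)
    (by rwa [wordPoly_eval_one_ne_zero_iff, wordPoly_polyWord hdeg])
  have hne : polyWord n f ≠ [] := by
    intro h0
    have hn : n = 0 := by simpa [h0] using hlen.symm
    subst hn
    have : f = 0 := by simpa using hdeg
    simp [this] at h1
  rw [isInvertible_coe_iff hne, wordPoly_polyWord hdeg, hlen] at hinv
  exact hf (hinv.isUnit_of_dvd' dvd_rfl hdvd)

theorem coeff_cyclotomic_prime (R : Type*) [Ring R] {r : ℕ} (hr : r.Prime) (i : ℕ) :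
    (cyclotomic r R).coeff i = if i < r then 1 else 0 := by
  have := Fact.mk hr
  simp [cyclotomic_prime, finsetSum_coeff, coeff_X_pow]

theorem not_isUnit_cyclotomic_prime (F : Type*) [Field F] {r : ℕ} (hr : r.Prime) :
    ¬ IsUnit (cyclotomic r F) := by
  refine not_isUnit_of_natDegree_pos _ ?_
  rw [natDegree_cyclotomic, Nat.totient_prime hr]
  have := hr.two_le
  omega

theorem eval_one_cyclotomic_ne_zero {p r : ℕ} [hp : Fact p.Prime] (hr : r.Prime) (hrp : r ≠ p) :
    (cyclotomic r (ZMod p)).eval 1 ≠ 0 := by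
  have := Fact.mk hr
  rw [eval_one_cyclotomic_prime, Ne, ZMod.natCast_eq_zero_iff, Nat.prime_dvd_prime_iff_eq hp.out hr]
  exact hrp.symm

theorem exists_prime_dvd_ne_of_ne_pow {p n : ℕ} (hn : n ≠ 0) (h : ¬ ∃ e, n = p ^ e) :
    ∃ r, r.Prime ∧ r ∣ n ∧ r ≠ p := by
  by_contra! H
  exact h ⟨_, Nat.eq_prime_pow_of_unique_prime_dvd hn fun {d} hd hdn => H d hd hdn⟩

/-- If `r < n`, then `Φ_r = 1 + X + ⋯ + X ^ (r - 1)` spells the primitive word `1ʳ0ⁿ⁻ʳ`. -/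
theorem AllInvertible.eq_of_prime_dvd {p n r : ℕ} [hp : Fact p.Prime] (h : AllInvertible p n)
    (hn : 0 < n) (hr : r.Prime) (hrn : r ∣ n) (hrp : r ≠ p) : n = r := by
  by_contra hne
  have hlt : r < n := lt_of_le_of_ne (Nat.le_of_dvd hn hrn) (Ne.symm hne)
  refine h.not_isPrimitive_polyWord (f := cyclotomic r (ZMod p)) ?_
    (not_isUnit_cyclotomic_prime _ hr) (cyclotomic_dvd_X_pow_sub_one _ hrn)
    (eval_one_cyclotomic_ne_zero hr hrp) ?_
  · rw [degree_cyclotomic]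
    exact_mod_cast (Nat.totient_le r).trans_lt hlt
  · refine isPrimitive_of_two_blocks hr.pos (by rwa [length_polyWord])
      (a := ⟨1, hp.out.one_lt⟩) (b := ⟨0, hp.out.pos⟩) (by simp) ?_ ?_
    · intro i hi hir
      have : Fact (1 < p) := ⟨hp.out.one_lt⟩
      rw [getElem_polyWord]
      simp [coeff_cyclotomic_prime _ hr, hir, ZMod.val_one]
    · intro i hi hir
      rw [getElem_polyWord]
      simp [coeff_cyclotomic_prime _ hr, hir.not_gt]

theorem isRootedPrime_iff {p q : ℕ} (hq : q.Prime) (hpq : p.Coprime q) :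
    IsRootedPrime p q ↔ orderOf (ZMod.unitOfCoprime p hpq) = q - 1 := by
  have := Fact.mk hq
  have hcard : Nat.card (ZMod q)ˣ = q - 1 := by
    rw [Nat.card_eq_fintype_card, ZMod.card_units]
  rw [← hcard, ← Nat.card_zpowers, Subgroup.card_eq_iff_eq_top]
  constructor
  · rintro ⟨-, u, hu, htop⟩
    rwa [← show u = ZMod.unitOfCoprime p hpq from Units.ext (by simpa using hu)]
  · exact fun h => ⟨hq, _, by simp, h⟩

theorem IsRootedPrime.coprime {p q : ℕ} (h : IsRootedPrime p q) : p.Coprime q := by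
  obtain ⟨-, u, hu, -⟩ := h
  rw [← ZMod.isUnit_iff_coprime]
  exact ⟨u, by simpa using hu⟩

theorem natDegree_of_irreducible_dvd_cyclotomic {p q : ℕ} [hp : Fact p.Prime] (hpq : p.Coprime q)
    {f : (ZMod p)[X]} (hf : Irreducible f) (hdvd : f ∣ cyclotomic q (ZMod p)) :
    f.natDegree = orderOf (ZMod.unitOfCoprime p hpq) := by
  -- Here `f := 1` is the exponent in the field cardinality `p ^ 1`.
  simpa using natDegree_of_dvd_cyclotomic_of_irreducible (f := 1) (p := p) (by simp) hpq hdvd hf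

theorem AllInvertible.isRootedPrime {p n : ℕ} [hp : Fact p.Prime] (h : AllInvertible p n)
    (hn : 0 < n) (hpow : ¬ ∃ e, n = p ^ e) : IsRootedPrime p n := by
  obtain ⟨r, hr, hrn, hrp⟩ := exists_prime_dvd_ne_of_ne_pow hn.ne' hpow
  obtain rfl := h.eq_of_prime_dvd hn hr hrn hrp
  have hpn : p.Coprime n := (Nat.coprime_primes hp.out hr).2 hrp.symm
  rw [isRootedPrime_iff hr hpn]
  obtain ⟨f, hf, hdvd⟩ :=
    WfDvdMonoid.exists_irreducible_factor (not_isUnit_cyclotomic_prime (ZMod p) hr)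
      (cyclotomic_ne_zero n (ZMod p))
  rw [← natDegree_of_irreducible_dvd_cyclotomic hpn hf hdvd]
  have hle : f.natDegree ≤ n - 1 := by
    rw [← Nat.totient_prime hr, ← natDegree_cyclotomic n (ZMod p)]
    exact natDegree_le_of_dvd hdvd (cyclotomic_ne_zero _ _)
  by_contra hne
  have hlt : f.natDegree < n - 1 := lt_of_le_of_ne hle hne
  refine h.not_isPrimitive_polyWord ?_ hf.not_isUnit
    (hdvd.trans (cyclotomic_dvd_X_pow_sub_one _ dvd_rfl)) ?_ ?_
  · rw [← natDegree_lt_iff_degree_lt hf.ne_zero]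
    omega
  · exact fun h0 => eval_one_cyclotomic_ne_zero hr hrp (eval_eq_zero_of_dvd_of_eval_eq_zero hdvd h0)
  · have hlen := length_polyWord n f
    -- The leading coefficient is nonzero, while the last letter is `0` because `f` has degree below
    -- `n - 1`.
    refine isPrimitive_of_prime_length (hlen.symm ▸ hr) (i := ⟨f.natDegree, by omega⟩)
      (j := ⟨n - 1, by omega⟩) ?_
    simp only [Fin.getElem_fin, getElem_polyWord, Ne, Fin.mk.injEq]
    rw [coeff_eq_zero_of_natDegree_lt hlt, ZMod.val_zero, ZMod.val_eq_zero, coeff_natDegree]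
    exact leadingCoeff_ne_zero.2 hf.ne_zero

theorem IsRootedPrime.irreducible_cyclotomic {p q : ℕ} [hp : Fact p.Prime]
    (h : IsRootedPrime p q) : Irreducible (cyclotomic q (ZMod p)) := by
  refine ZMod.irreducible_of_dvd_cyclotomic_of_natDegree
    (hp.out.coprime_iff_not_dvd.1 h.coprime) dvd_rfl ?_
  rw [natDegree_cyclotomic, Nat.totient_prime h.1, (isRootedPrime_iff h.1 h.coprime).1 h]

theorem IsRootedPrime.allInvertible {p q : ℕ} [hp : Fact p.Prime] (h : IsRootedPrime p q) :
    AllInvertible p q := by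
  intro c
  induction c using Quotient.inductionOn' with
  | h w =>
    intro hlen hap hwt
    change w.length = q at hlen
    subst hlen
    have hq := h.1
    have := Fact.mk hq
    have hap := (isAperiodic_coe w).1 hap
    have hwt := wordPoly_eval_one_ne_zero_iff.1 hwt
    have hW : wordPoly w ≠ 0 := by rintro h0; simp [h0] at hwt
    refine (isInvertible_coe_iff (List.length_pos_iff.1 hq.pos)).2 ?_
    rw [← cyclotomic_prime_mul_X_sub_one]
    refine IsCoprime.mul_right (IsCoprime.symm ?_) (IsCoprime.symm ?_)
    · rw [h.irreducible_cyclotomic.coprime_iff_not_dvd]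
      rintro ⟨g, hg⟩
      have hg0 : g ≠ 0 := by rintro rfl; simp [hg] at hW
      have hdeg := (natDegree_lt_iff_degree_lt hW).2 (degree_wordPoly_lt w)
      rw [hg, natDegree_mul (cyclotomic_ne_zero _ _) hg0, natDegree_cyclotomic,
        Nat.totient_prime hq] at hdeg
      -- `Φ_q` has degree `q - 1` and `W` degree below `q`, so `W` is a scalar multiple of `Φ_q` and
      -- all letters are equal.
      rw [eq_C_of_natDegree_eq_zero (show g.natDegree = 0 by omega)] at hg
      refine not_isPrimitive_of_const hq.one_lt
        (a := ⟨(g.coeff 0).val, ZMod.val_lt _⟩) (fun b hb => ?_) hap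
      obtain ⟨i, hi, rfl⟩ := List.getElem_of_mem hb
      have := coeff_wordPoly w i hi
      rw [hg, coeff_mul_C, coeff_cyclotomic_prime _ hq, if_pos hi, one_mul] at this
      ext
      simp [this, ZMod.val_natCast, Nat.mod_eq_of_lt]
    · rw [← C_1, (irreducible_X_sub_C (1 : ZMod p)).coprime_iff_not_dvd, dvd_iff_isRoot]
      exact hwt

theorem necklaceConjectureAt_iff {p : ℕ} (hp : p.Prime) :
    NecklaceConjectureAt p ↔ ArtinConjectureAt p := by
  have := Fact.mk hp
  rw [NecklaceConjectureAt, ArtinConjectureAt]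
  suffices h : {n : ℕ | 0 < n ∧ (¬ ∃ e : ℕ, n = p ^ e) ∧ AllInvertible p n} =
      {q : ℕ | IsRootedPrime p q} by rw [h]
  ext n
  refine ⟨fun ⟨hn, hpow, h⟩ => h.isRootedPrime hn hpow,
    fun h => ⟨h.1.pos, ?_, h.allInvertible⟩⟩
  -- A rooted prime is coprime to `p`, which leaves only `p ^ 0 = 1`, not a prime.
  rintro ⟨e, rfl⟩
  have hcop := h.coprime
  rcases e with _ | e
  · exact Nat.not_prime_one (by simpa using h.1)
  · exact hp.one_lt.ne' (Nat.Coprime.eq_one_of_dvd hcop (dvd_pow_self p e.succ_ne_zero))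

end InvNeck

theorem mainTheorem9 :
    (∀ p : ℕ, p.Prime →
      (InvNeck.NecklaceConjectureAt p ↔ InvNeck.ArtinConjectureAt (p : ℤ))) ∧
    ((∀ p : ℕ, p.Prime → InvNeck.NecklaceConjectureAt p) ↔
      (∀ p : ℕ, p.Prime → InvNeck.ArtinConjectureAt (p : ℤ))) :=
  ⟨fun _ hp => InvNeck.necklaceConjectureAt_iff hp,
    forall₂_congr fun _ hp => InvNeck.necklaceConjectureAt_iff hp⟩
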